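/- Let $F$ be a field of characteristic $0$ with algebraic closure $\overline F$, let $n\ge 0$, and write $R(n,A)=A[x_{11},\dots,x_{nn}]$. A subset of $\mathrm{GL}(n,\overline F)$ is Zariski closed if it is the common zero set in $\mathrm{GL}(n,\overline F)$ of a set of polynomials in $R(n,\overline F)$; bars over subsets of $\mathrm{GL}(n,\overline F)$ denote Zariski closure. An algebraic subgroup is a Zariski closed subgroup. A set $S\subset R(n,F)$ is a set of defining polynomials for $X\subset\mathrm{GL}(n,\overline F)$ if $X$ is the set of all $g\in \mathrm{GL}(n,\overline F)$ with $f(g)=0$ for all $f\in S$; and $X$ is defined over $F$ if the ideal of all polynomials in $R(n,\overline F)$ vanishing on $X$ is generated by elements of $R(n,F)$. Let $G_1,G_2\subset\mathrm{GL}(n,\overline F)$ be algebraic subgroups, connected in the Zariski topology. Consider the following algorithm. Start with $A_0=\{1\}$. In each round pass from $A_k$ to $$A_{k+1}=\overline{\;\overline{A_kG_1}\,G_2\;},$$ and stop, returning $A_k$, as soon as $A_{k+1}=A_k$. Then: 1. The algorithm terminates: there is an $m\ge 0$ with $A_{m+1}=A_m$. 2. It is correct: whenever $A_{m+1}=A_m$,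 the set $A_m$ is the subgroup $H$ of $\mathrm{GL}(n,\overline F)$ generated by $G_1$ and $G_2$. Moreover, $H$ is an algebraic subgroup, so it is the smallest algebraic subgroup of $\mathrm{GL}(n,\overline F)$ containing $G_1$ and $G_2$. 3. If $G_1$ and $G_2$ are defined over $F$, then so is $H$. 4. The algorithm can be carried out on polynomials over $F$ by elimination. For ideals $I,J$ of $R(n,F)$ let $E(I,J)$ be the ideal of all $f\in R(n,F)$ such that $f(xy)$ lies in the ideal of $F[x_{ij},y_{ij},t\mid 1\le i,j\le n]$ generated by all $p(x)$ with $p\in I$, all $q(y)$ with $q\in J$, and $t\det(x)\det(y)-1$, where $x=(x_{ij})$ and $y=(y_{ij})$. Let $S_1,S_2\subset R(n,F)$ be finite sets of defining polynomials for $G_1,G_2$; let $I_0$ be the ideal generated by the $x_{ij}-\delta_{ij}$, and put $I_{k+1}=E(E(I_k,(S_1)),(S_2))$. Then for every $k$ the set $A_k$ is the zero set of $I_k$ in $\mathrm{GL}(n,\overline F)$. Moreover, if $A_{m+1}=A_m$, then $I_m$ has a finite generating set that is a set of defining polynomials in $R(n,F)$ for $H$. -/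

import Mathlib

open scoped MatrixGroups Pointwise

namespace GenAlgGroup

/-- The polynomial ring `R(n, A) = A[x₁₁, …, xₙₙ]` in `n²` indeterminates. -/
abbrev MatPoly (n : ℕ) (A : Type*) [CommSemiring A] : Type _ :=
  MvPolynomial (Fin n × Fin n) A

section Zariski

variable {F K : Type*} [Field F] [Field K] [Algebra F K] {n : ℕ}

/-- The value `f(g)` of a polynomial `f ∈ R(n, F)` at the entries of a matrix `g ∈ GL(n, K)`. -/
noncomputable def evalGL (g : GL (Fin n) K) : MatPoly n F →ₐ[F] K :=
  MvPolynomial.aeval fun p => (g : Matrix (Fin n) (Fin n) K) p.1 p.2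

/-- The set of all `g ∈ GL(n, K)` at which every polynomial of `S ⊆ R(n, F)` vanishes.
`S` is a set of defining polynomials of a subset `X` of `GL(n, K)` if `zeroSet K S = X`. -/
def zeroSet (K : Type*) [Field K] [Algebra F K] (S : Set (MatPoly n F)) : Set (GL (Fin n) K) :=
  {g | ∀ f ∈ S, evalGL g f = 0}

/-- The Zariski topology on `GL(n, K)`: the closed sets are the zero sets of sets of
polynomials with coefficients in `K`. -/
@[reducible]
def zariski (n : ℕ) (K : Type*) [Field K] : TopologicalSpace (GL (Fin n) K) :=
  TopologicalSpace.ofClosed {X | ∃ S : Set (MatPoly n K), X = zeroSet K S}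
    ⟨{1}, by ext g; simp [zeroSet]⟩
    (by
      intro A hA
      refine ⟨{f | ∃ S, zeroSet K S ∈ A ∧ f ∈ S}, ?_⟩
      ext g
      constructor
      · rintro hg f ⟨S, hS, hf⟩
        exact hg _ hS f hf
      · intro hg X hX
        obtain ⟨S, rfl⟩ := hA hX
        exact fun f hf => hg f ⟨S, hX, hf⟩)
    (by
      rintro X ⟨S, rfl⟩ Y ⟨T, rfl⟩
      refine ⟨{f | ∃ s ∈ S, ∃ t ∈ T, f = s * t}, ?_⟩
      ext g
      constructor
      · rintro (hg | hg) f ⟨s, hs, t, ht, rfl⟩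
        · simp [hg s hs]
        · simp [hg t ht]
      · intro hg
        by_contra hcon
        simp only [Set.mem_union, not_or, zeroSet, Set.mem_ofPred_eq, not_forall] at hcon
        obtain ⟨⟨s, hs, hs0⟩, t, ht, ht0⟩ := hcon
        have h := hg (s * t) ⟨s, hs, t, ht, rfl⟩
        rw [map_mul] at h
        exact (mul_ne_zero hs0 ht0) h)

/-- The Zariski closure of a subset of `GL(n, K)`. -/
def zariskiClosure (X : Set (GL (Fin n) K)) : Set (GL (Fin n) K) :=
  @closure _ (zariski n K) X

/-- A subgroup of `GL(n, K)` is algebraic if it is the zero set of a set of polynomials. -/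
def IsAlgebraicSubgroup (G : Subgroup (GL (Fin n) K)) : Prop :=
  ∃ S : Set (MatPoly n K), (G : Set (GL (Fin n) K)) = zeroSet K S

/-- The subgroup is connected in the Zariski topology. -/
def IsZariskiConnected (G : Subgroup (GL (Fin n) K)) : Prop :=
  @IsConnected _ (zariski n K) (G : Set (GL (Fin n) K))

/-- The ideal `I(X) ⊆ R(n, K)` of all polynomials that vanish on `X ⊆ GL(n, K)`. -/
def idealOf (X : Set (GL (Fin n) K)) : Ideal (MatPoly n K) where
  carrier := {f | ∀ g ∈ X, evalGL g f = 0}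
  add_mem' := fun ha hb g hg => by rw [map_add, ha g hg, hb g hg, add_zero]
  zero_mem' := fun g _ => map_zero _
  smul_mem' := fun c f hf g hg => by rw [smul_eq_mul, map_mul, hf g hg, mul_zero]

/-- `X` is defined over `F` if `I(X)` is generated by polynomials with coefficients in `F`. -/
def IsDefinedOver (F : Type*) [Field F] [Algebra F K] (X : Set (GL (Fin n) K)) : Prop :=
  ∃ S : Set (MatPoly n F), idealOf X = Ideal.span (MvPolynomial.map (algebraMap F K) '' S)

/-- One round of the iteration: first replace `G'` by the Zariski closure of `G' G₁`, then
replace the result by the Zariski closure of its product with `G₂`. -/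
def round (G₁ G₂ : Subgroup (GL (Fin n) K)) (G' : Set (GL (Fin n) K)) : Set (GL (Fin n) K) :=
  zariskiClosure
    (zariskiClosure (G' * (G₁ : Set (GL (Fin n) K))) * (G₂ : Set (GL (Fin n) K)))

/-- The set held by the algorithm after `k` rounds, starting from the trivial subgroup. -/
def afterRounds (G₁ G₂ : Subgroup (GL (Fin n) K)) (k : ℕ) : Set (GL (Fin n) K) :=
  (round G₁ G₂)^[k] {1}

/-- The algorithm stops after `k` rounds: the next round does not change the set. -/
def StopsAt (G₁ G₂ : Subgroup (GL (Fin n) K)) (k : ℕ) : Prop :=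
  round G₁ G₂ (afterRounds G₁ G₂ k) = afterRounds G₁ G₂ k

end Zariski

section Elimination

variable {F : Type*} [Field F] {n : ℕ}

/-- Indeterminates used for a product of matrices: the entries of a matrix `x`, the entries of
a matrix `y`, and one further indeterminate `t` (which is `none`). -/
abbrev PairVar (n : ℕ) : Type := Option ((Fin n × Fin n) ⊕ (Fin n × Fin n))

/-- The generic matrix `x`. -/
noncomputable def genX (n : ℕ) (F : Type*) [Field F] :
    Matrix (Fin n) (Fin n) (MvPolynomial (PairVar n) F) :=
  Matrix.of fun i j => MvPolynomial.X (some (Sum.inl (i, j)))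

/-- The generic matrix `y`. -/
noncomputable def genY (n : ℕ) (F : Type*) [Field F] :
    Matrix (Fin n) (Fin n) (MvPolynomial (PairVar n) F) :=
  Matrix.of fun i j => MvPolynomial.X (some (Sum.inr (i, j)))

/-- The ideal of `F[x, y, t]` generated by `f(x)` for `f ∈ I`, by `f(y)` for `f ∈ J`, and by
`t det(x) det(y) - 1`, which expresses that `x` and `y` are invertible. -/
noncomputable def pairIdeal (I J : Ideal (MatPoly n F)) :
    Ideal (MvPolynomial (PairVar n) F) :=
  I.map (MvPolynomial.rename fun p => (some (Sum.inl p) : PairVar n)) ⊔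
  J.map (MvPolynomial.rename fun p => (some (Sum.inr p) : PairVar n)) ⊔
  Ideal.span {MvPolynomial.X none * (genX n F).det * (genY n F).det - 1}

/-- The result of eliminating `x`, `y`, `t` from the equations `z = x y` and the equations of
`pairIdeal I J`: the ideal of all `f ∈ F[z]` with `f(x y) ∈ pairIdeal I J`. -/
noncomputable def productElim (I J : Ideal (MatPoly n F)) : Ideal (MatPoly n F) :=
  (pairIdeal I J).comap
    (MvPolynomial.aeval (fun p => (genX n F * genY n F) p.1 p.2) :
      MatPoly n F →ₐ[F] MvPolynomial (PairVar n) F)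

/-- The ideal of the trivial group, generated by the entries of `x - 1`. -/
noncomputable def trivialIdeal (n : ℕ) (F : Type*) [Field F] : Ideal (MatPoly n F) :=
  Ideal.span (Set.range fun p : Fin n × Fin n =>
    MvPolynomial.X p - MvPolynomial.C ((1 : Matrix (Fin n) (Fin n) F) p.1 p.2))

/-- The ideal held by the algorithm after `k` rounds, each closure of a product being computed
by elimination over `F`, when `S₁` and `S₂` are the defining polynomials of the input. -/
noncomputable def idealAfterRounds (S₁ S₂ : Finset (MatPoly n F)) (k : ℕ) :
    Ideal (MatPoly n F) :=
  (fun I => productElim (productElim I (Ideal.span (S₁ : Set (MatPoly n F))))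
    (Ideal.span (S₂ : Set (MatPoly n F))))^[k] (trivialIdeal n F)

end Elimination

end GenAlgGroup

/-!
Let `H = G₁ ⊔ G₂`. Multiplication on `GL(n, K)` is only separately continuous for the Zariski
topology, but this suffices to show that products of irreducible sets are irreducible, and that a
set and its closure give products with the same closure. A connected closed subgroup is irreducible
(`Subgroup.isIrreducible_of_isConnected`), so the `k`-th set `A_k` of the iteration is the closure of
the irreducible set `P_k = G₁ G₂ ⋯ G₁ G₂`. The sets `A_k` increase and their vanishing ideals are
prime ideals of finite height, whence termination (`exists_succ_eq_of_isIrreducible`).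

A stable `A_m` contains `1` and is closed under right multiplication by `G₁` and `G₂`, so it is the
closure of `H`. That `H` is already closed follows from Chevalley's theorem: the image `P_m` of a
product variety contains a nonempty relatively open subset `U` of its closure (`hasOpenCore_mul`),
and for every `a` in the irreducible group `A_m` the open sets `U` and `a U⁻¹` meet, so that
`a ∈ U U ⊆ H` (`Subgroup.isClosed_of_hasOpenCore`).

Elimination over `F` computes the closure of a product of zero sets (`zeroSet_productElim`): by the
Nullstellensatz a polynomial over `K` vanishing on the product has a power whose pullback lies in
the ideal of the pairs, and `F`-linear functionals `K → F`, applied to coefficients, reduce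
membership in an ideal extended from `F` to membership over `F`. Hence `H` is the zero set of
polynomials over `F` as soon as `G₁` and `G₂` are. In characteristic `0` such a zero set is defined
over `F` (`isDefinedOver_zeroSet`): on a finite extension of `F` every functional is of the form
`x ↦ tr (c x)`, so applying it to the coefficients of a polynomial gives a combination of its
conjugates, and the vanishing ideal is stable under conjugation.
-/

/-! ### Irreducibility in groups with separately continuous multiplication -/

section SeparatelyContinuous

variable {G : Type*} [TopologicalSpace G] [Group G] [SeparatelyContinuousMul G]

theorem IsPreirreducible.mul_of_separatelyContinuous {A B : Set G} (hA : IsPreirreducible A)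
    (hB : IsPreirreducible B) : IsPreirreducible (A * B) := by
  rintro U V hU hV ⟨_, ⟨a₁, ha₁, b₁, hb₁, rfl⟩, hU₁⟩ ⟨_, ⟨a₂, ha₂, b₂, hb₂, rfl⟩, hV₂⟩
  -- Slicing: for each open `W`, the set of `a` such that `a B` meets `W` is open.
  have hopen : ∀ W : Set G, IsOpen W → IsOpen {a | ∃ b ∈ B, a * b ∈ W} := by
    intro W hW
    have : {a | ∃ b ∈ B, a * b ∈ W} = ⋃ b ∈ B, (· * b) ⁻¹' W := by ext; simp
    rw [this]
    exact isOpen_biUnion fun b _ => hW.preimage SeparatelyContinuousMul.continuous_mul_const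
  obtain ⟨a, ha, ⟨b, hb, hab⟩, b', hb', hab'⟩ := hA _ _ (hopen U hU) (hopen V hV)
    ⟨a₁, ha₁, b₁, hb₁, hU₁⟩ ⟨a₂, ha₂, b₂, hb₂, hV₂⟩
  have hcont : Continuous (a * ·) := SeparatelyContinuousMul.continuous_const_mul
  obtain ⟨c, hc, hcU, hcV⟩ := hB _ _ (hU.preimage hcont) (hV.preimage hcont)
    ⟨b, hb, hab⟩ ⟨b', hb', hab'⟩
  exact ⟨a * c, Set.mul_mem_mul ha hc, hcU, hcV⟩

theorem IsIrreducible.mul_of_separatelyContinuous {A B : Set G} (hA : IsIrreducible A)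
    (hB : IsIrreducible B) : IsIrreducible (A * B) :=
  ⟨hA.1.mul hB.1, hA.2.mul_of_separatelyContinuous hB.2⟩

/-- A connected group with Noetherian topology is irreducible: some point, hence by translation
every point, has an irreducible open neighbourhood, so that irreducible components are open. -/
theorem irreducibleSpace_of_connectedSpace_of_noetherianSpace
    [TopologicalSpace.NoetherianSpace G] [ConnectedSpace G] : IrreducibleSpace G := by
  obtain ⟨o, ho, ⟨x₀, hx₀⟩, hoZ⟩ :=
    TopologicalSpace.NoetherianSpace.exists_isOpen_nonempty_subset_irreducibleComponent
      (irreducibleComponent (1 : G)) (irreducibleComponent_mem_irreducibleComponents 1)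
  have hoirr : IsPreirreducible o :=
    isIrreducible_irreducibleComponent.isPreirreducible.open_subset ho hoZ
  have hnhd : ∀ x : G, ∃ W : Set G, IsOpen W ∧ x ∈ W ∧ IsPreirreducible W := by
    intro x
    refine ⟨(x₀ * x⁻¹ * ·) ⁻¹' o,
      ho.preimage SeparatelyContinuousMul.continuous_const_mul, by simpa using hx₀, ?_⟩
    have : (x₀ * x⁻¹ * ·) ⁻¹' o = (x * x₀⁻¹ * ·) '' o := by
      ext y
      constructor
      · intro hy
        exact ⟨_, hy, by group⟩
      · rintro ⟨z, hz, rfl⟩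
        simpa [mul_assoc] using hz
    rw [this]
    exact hoirr.image _
      (SeparatelyContinuousMul.continuous_const_mul (a := x * x₀⁻¹)).continuousOn
  have hopen : IsOpen (irreducibleComponent (1 : G)) := by
    refine isOpen_iff_forall_mem_open.2 fun x hx => ?_
    obtain ⟨W, hW, hxW, hWirr⟩ := hnhd x
    have hsub : irreducibleComponent (1 : G) ⊆ closure W :=
      (subset_closure_inter_of_isPreirreducible_of_isOpen
        isIrreducible_irreducibleComponent.isPreirreducible hW ⟨x, hx, hxW⟩).trans
        (closure_mono Set.inter_subset_right)
    have heq := (irreducibleComponent_property (1 : G)).2.2 (closure W)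
      (isPreirreducible_iff_closure.2 hWirr) hsub
    exact ⟨W, heq ▸ subset_closure, hW, hxW⟩
  have huniv : irreducibleComponent (1 : G) = Set.univ :=
    IsClopen.eq_univ ⟨isClosed_irreducibleComponent, hopen⟩ ⟨1, mem_irreducibleComponent⟩
  rw [irreducibleSpace_def, Set.top_eq_univ, ← huniv]
  exact isIrreducible_irreducibleComponent

theorem Subgroup.isIrreducible_of_isConnected [TopologicalSpace.NoetherianSpace G]
    (H : Subgroup G) (hH : IsConnected (H : Set G)) : IsIrreducible (H : Set G) := by
  have : SeparatelyContinuousMul H :=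
    { continuous_const_mul := fun {a} => by
        refine Continuous.subtype_mk (f := fun x : H => (a : G) * x) ?_ _
        exact (SeparatelyContinuousMul.continuous_const_mul (a := (a : G))).comp
          continuous_subtype_val
      continuous_mul_const := fun {a} => by
        refine Continuous.subtype_mk (f := fun x : H => (x : G) * a) ?_ _
        exact (SeparatelyContinuousMul.continuous_mul_const (a := (a : G))).comp
          continuous_subtype_val }
  have : ConnectedSpace H := isConnected_iff_connectedSpace.1 hH
  have : TopologicalSpace.NoetherianSpace H :=
    TopologicalSpace.NoetherianSpace.set (H : Set G)
  have : IrreducibleSpace H := irreducibleSpace_of_connectedSpace_of_noetherianSpace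
  exact isIrreducible_iff_irreducibleSpace.2 this

/-- Replacing a factor by its closure does not change the closure of a product. -/
theorem closure_closure_mul (A B : Set G) : closure (closure A * B) = closure (A * B) := by
  refine (closure_minimal ?_ isClosed_closure).antisymm
    (closure_mono (Set.mul_subset_mul_right subset_closure))
  rintro _ ⟨a, ha, b, hb, rfl⟩
  exact map_mem_closure (f := (· * b)) SeparatelyContinuousMul.continuous_mul_const ha
    fun x hx => Set.mul_mem_mul hx hb

/-- With separately continuous multiplication, translations by elements of a subgroup preserve its
closure; joint continuity would be needed for `Subgroup.topologicalClosure`. -/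
theorem Subgroup.mul_mem_closure_left (H : Subgroup G) {a x : G} (ha : a ∈ H)
    (hx : x ∈ _root_.closure (H : Set G)) : a * x ∈ _root_.closure (H : Set G) :=
  map_mem_closure (f := (a * ·)) SeparatelyContinuousMul.continuous_const_mul hx
    fun _ hy => H.mul_mem ha hy

theorem Subgroup.mul_mem_closure_right (H : Subgroup G) {a x : G} (ha : a ∈ H)
    (hx : x ∈ _root_.closure (H : Set G)) : x * a ∈ _root_.closure (H : Set G) :=
  map_mem_closure (f := (· * a)) SeparatelyContinuousMul.continuous_mul_const hx
    fun _ hy => H.mul_mem hy ha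

/-- A set has an open core if it contains a nonempty relatively open subset of its closure. -/
def HasOpenCore (P : Set G) : Prop :=
  ∃ V : Set G, IsOpen V ∧ (closure P ∩ V).Nonempty ∧ closure P ∩ V ⊆ P

/-- A subgroup is closed if its closure is irreducible and it contains a nonempty relatively open
subset `U` of its closure: for `a` in the closure, the open subsets `U` and `a U⁻¹` meet. -/
theorem Subgroup.isClosed_of_hasOpenCore (hinv : Continuous fun x : G => x⁻¹) (H : Subgroup G)
    (hirr : IsIrreducible (H : Set G)) (hcore : HasOpenCore (H : Set G)) :
    IsClosed (H : Set G) := by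
  obtain ⟨V, hV, ⟨u, huH, huV⟩, hVH⟩ := hcore
  refine isClosed_of_closure_subset fun a ha => ?_
  have hcont : Continuous fun x : G => x⁻¹ * a :=
    (SeparatelyContinuousMul.continuous_mul_const (a := a)).comp hinv
  have hu : u⁻¹ ∈ H := H.inv_mem (hVH ⟨huH, huV⟩)
  obtain ⟨x, hx, hxV, hxa⟩ := (isIrreducible_iff_closure.2 hirr).2 V _ hV (hV.preimage hcont)
    ⟨u, huH, huV⟩ ⟨a * u⁻¹, H.mul_mem_closure_right hu ha, by simpa using huV⟩
  have hxH : x ∈ H := hVH ⟨hx, hxV⟩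
  have := hVH ⟨H.mul_mem_closure_left (H.inv_mem hxH) ha, hxa⟩
  simpa using H.mul_mem hxH this

end SeparatelyContinuous

/-! ### The Zariski topology on `GL(n, K)` -/

namespace GenAlgGroup

section ZariskiTopology

variable {F K : Type*} [Field F] [Field K] [Algebra F K] {n : ℕ}

attribute [local instance] zariski

theorem isClosed_iff_exists_zeroSet {X : Set (GL (Fin n) K)} :
    IsClosed X ↔ ∃ S : Set (MatPoly n K), X = zeroSet K S := by
  rw [← isOpen_compl_iff]
  change Xᶜᶜ ∈ {X | ∃ S : Set (MatPoly n K), X = zeroSet K S} ↔ _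
  rw [compl_compl, Set.mem_ofPred_eq]

theorem evalGL_X (g : GL (Fin n) K) (p : Fin n × Fin n) :
    evalGL g (MvPolynomial.X p : MatPoly n F) = g.1 p.1 p.2 := by
  simp [evalGL]

theorem evalGL_C (g : GL (Fin n) K) (c : F) :
    evalGL g (MvPolynomial.C c : MatPoly n F) = algebraMap F K c := by
  simp [evalGL]

theorem evalGL_map (g : GL (Fin n) K) (f : MatPoly n F) :
    evalGL g (MvPolynomial.map (algebraMap F K) f) = evalGL g f := by
  simp [evalGL, MvPolynomial.aeval_map_algebraMap]

/-- The zero set of polynomials over a subfield is Zariski closed. -/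
theorem isClosed_zeroSet (S : Set (MatPoly n F)) : IsClosed (zeroSet K S) := by
  refine isClosed_iff_exists_zeroSet.2 ⟨MvPolynomial.map (algebraMap F K) '' S, ?_⟩
  ext g
  simp [zeroSet, evalGL_map]

theorem zeroSet_idealOf {X : Set (GL (Fin n) K)} (hX : IsClosed X) :
    zeroSet K (idealOf X : Set (MatPoly n K)) = X := by
  obtain ⟨S, rfl⟩ := isClosed_iff_exists_zeroSet.1 hX
  exact Set.Subset.antisymm (fun g hg f hf => hg f fun h hh => hh f hf)
    fun g hg f hf => hf g hg

theorem mem_closure_iff_forall_evalGL {X : Set (GL (Fin n) K)} {g : GL (Fin n) K} :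
    g ∈ closure X ↔ ∀ f ∈ idealOf X, evalGL g f = 0 := by
  constructor
  · intro hg f hf
    have hsub : closure X ⊆ zeroSet K {f} :=
      closure_minimal (fun x hx h hh => by rw [hh]; exact hf x hx) (isClosed_zeroSet _)
    exact hsub hg f rfl
  · intro hg
    rw [← zeroSet_idealOf (isClosed_closure (s := X))]
    exact fun f hf => hg f fun x hx => hf x (subset_closure hx)

theorem isClosed_of_isAlgebraicSubgroup {G : Subgroup (GL (Fin n) K)}
    (hG : IsAlgebraicSubgroup G) : IsClosed (G : Set (GL (Fin n) K)) :=
  isClosed_iff_exists_zeroSet.2 hG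

theorem zeroSet_span (S : Set (MatPoly n F)) :
    zeroSet K (Ideal.span S : Set (MatPoly n F)) = zeroSet K S := by
  refine Set.Subset.antisymm (fun g hg f hf => hg f (Ideal.subset_span hf)) fun g hg => ?_
  have : Ideal.span S ≤ RingHom.ker (evalGL (F := F) g) := Ideal.span_le.2 hg
  exact fun f hf => this hf

/-- Closed sets satisfy the descending chain condition because their ideals satisfy the ascending
chain condition. -/
instance noetherianSpace_zariski : TopologicalSpace.NoetherianSpace (GL (Fin n) K) := by
  refine ((TopologicalSpace.noetherianSpace_TFAE (GL (Fin n) K)).out 0 1).2 ?_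
  have hanti : StrictAnti fun X : TopologicalSpace.Closeds (GL (Fin n) K) =>
      idealOf (X : Set (GL (Fin n) K)) := by
    intro X Y hXY
    refine lt_of_le_of_ne (fun f hf g hg => hf g (hXY.le hg)) fun heq => hXY.ne ?_
    refine TopologicalSpace.Closeds.ext ?_
    rw [← zeroSet_idealOf X.isClosed, ← zeroSet_idealOf Y.isClosed]
    exact congrArg (fun I : Ideal (MatPoly n K) => zeroSet K (I : Set (MatPoly n K))) heq.symm
  exact hanti.wellFoundedLT

/-- A map of `GL(n, K)` into itself is continuous if every polynomial function on `GL(n, K)` pulls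
back to a function with the same zeros as some polynomial function. -/
theorem continuous_of_forall_exists_evalGL {φ : GL (Fin n) K → GL (Fin n) K}
    (h : ∀ f : MatPoly n K, ∃ f' : MatPoly n K, ∀ g, evalGL g f' = 0 ↔ evalGL (φ g) f = 0) :
    Continuous φ := by
  refine continuous_iff_isClosed.2 fun X hX => ?_
  obtain ⟨S, rfl⟩ := isClosed_iff_exists_zeroSet.1 hX
  choose r hr using h
  refine isClosed_iff_exists_zeroSet.2 ⟨r '' S, ?_⟩
  ext g
  simp [zeroSet, hr]

theorem evalGL_aeval {φ : GL (Fin n) K → GL (Fin n) K} (q : Fin n × Fin n → MatPoly n K)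
    (h : ∀ g p, evalGL g (q p) = (φ g).1 p.1 p.2) (f : MatPoly n K) (g : GL (Fin n) K) :
    evalGL g (MvPolynomial.aeval q f) = evalGL (φ g) f := by
  have : (evalGL g).comp (MvPolynomial.aeval q) = evalGL (F := K) (φ g) := by
    ext p
    simp [h, evalGL_X]
  exact DFunLike.congr_fun this f

instance separatelyContinuousMul_zariski : SeparatelyContinuousMul (GL (Fin n) K) where
  continuous_const_mul {a} := continuous_of_forall_exists_evalGL fun f =>
    ⟨_, fun g => by
      rw [evalGL_aeval (φ := (a * ·)) (fun p => ∑ k, MvPolynomial.C (a.1 p.1 k) *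
        MvPolynomial.X (k, p.2)) _ f g]
      intro g p
      simp [evalGL_X, Matrix.mul_apply]⟩
  continuous_mul_const {a} := continuous_of_forall_exists_evalGL fun f =>
    ⟨_, fun g => by
      rw [evalGL_aeval (φ := (· * a)) (fun p => ∑ k, MvPolynomial.X (p.1, k) *
        MvPolynomial.C (a.1 k p.2)) _ f g]
      intro g p
      simp [evalGL_X, Matrix.mul_apply]⟩

theorem evalGL_det (g : GL (Fin n) K) :
    evalGL g (Matrix.mvPolynomialX (Fin n) (Fin n) F).det = g.1.det := by
  rw [AlgHom.map_det]
  congr 1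
  ext i j
  simp [evalGL_X]

theorem evalGL_adjugate (g : GL (Fin n) K) (i j : Fin n) :
    evalGL g ((Matrix.mvPolynomialX (Fin n) (Fin n) F).adjugate i j) = g.1.adjugate i j := by
  have h := (evalGL (F := F) g).map_adjugate (Matrix.mvPolynomialX (Fin n) (Fin n) F)
  have h' := congrFun (congrFun h i) j
  rw [AlgHom.mapMatrix_apply, Matrix.map_apply] at h'
  rw [h']
  congr 2
  ext i j
  simp [evalGL_X]

theorem det_ne_zero (g : GL (Fin n) K) : g.1.det ≠ 0 :=
  g.isUnit.map (Matrix.detMonoidHom) |>.ne_zero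

/-- Clearing denominators in `f(g⁻¹)`, where the entries of `g⁻¹` are those of the adjugate divided
by the determinant. -/
theorem exists_evalGL_eq_det_pow_mul (f : MatPoly n K) : ∃ (N : ℕ) (f' : MatPoly n K),
    ∀ g : GL (Fin n) K, evalGL g f' = g.1.det ^ N * evalGL g⁻¹ f := by
  induction f using MvPolynomial.induction_on with
  | C c => exact ⟨0, MvPolynomial.C c, fun g => by simp⟩
  | add p q hp hq =>
    obtain ⟨N, p', hp'⟩ := hp
    obtain ⟨M, q', hq'⟩ := hq
    let d := (Matrix.mvPolynomialX (Fin n) (Fin n) K).det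
    refine ⟨N + M, d ^ M * p' + d ^ N * q', fun g => ?_⟩
    simp only [d, map_add, map_mul, map_pow, evalGL_det, hp', hq']
    ring
  | mul_X p i hp =>
    obtain ⟨N, p', hp'⟩ := hp
    refine ⟨N + 1, p' * (Matrix.mvPolynomialX (Fin n) (Fin n) K).adjugate i.1 i.2, fun g => ?_⟩
    have hinv : (g⁻¹).1 i.1 i.2 = (g.1.det)⁻¹ * g.1.adjugate i.1 i.2 := by
      rw [Matrix.coe_units_inv, Matrix.inv_def]
      simp
    rw [map_mul, map_mul, hp', evalGL_adjugate, evalGL_X, hinv]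
    field_simp [det_ne_zero g]
    ring

theorem continuous_inv_zariski : Continuous fun g : GL (Fin n) K => g⁻¹ :=
  continuous_of_forall_exists_evalGL fun f => by
    obtain ⟨N, f', hf'⟩ := exists_evalGL_eq_det_pow_mul f
    exact ⟨f', fun g => by simp [hf', det_ne_zero g]⟩

theorem zeroSet_trivialIdeal :
    zeroSet K (trivialIdeal n F : Set (MatPoly n F)) = {1} := by
  rw [trivialIdeal, zeroSet_span]
  ext g
  simp only [zeroSet, Set.forall_mem_range, Set.mem_ofPred_eq, Set.mem_singleton_iff, map_sub,
    evalGL_X, evalGL_C, sub_eq_zero, Prod.forall]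
  rw [Units.ext_iff, ← Matrix.ext_iff]
  refine forall₂_congr fun i j => ?_
  rw [Units.val_one, Matrix.one_apply, Matrix.one_apply]
  split_ifs <;> simp

theorem isClosed_singleton_one : IsClosed ({1} : Set (GL (Fin n) K)) := by
  rw [← zeroSet_trivialIdeal (F := K)]
  exact isClosed_zeroSet _

theorem isPrime_idealOf {X : Set (GL (Fin n) K)} (hX : IsIrreducible X) :
    (idealOf X).IsPrime := by
  refine ⟨fun h => ?_, fun {f g} hfg => ?_⟩
  · obtain ⟨x, hx⟩ := hX.nonempty
    have : (1 : MatPoly n K) ∈ idealOf X := h ▸ Submodule.mem_top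
    simpa using this x hx
  · have hcov : X ⊆ zeroSet K {f} ∪ zeroSet K {g} := by
      intro x hx
      have := hfg x hx
      rw [map_mul, mul_eq_zero] at this
      simpa [zeroSet] using this
    exact (isPreirreducible_iff_isClosed_union_isClosed.1 hX.2 _ _ (isClosed_zeroSet _)
      (isClosed_zeroSet _) hcov).imp (fun h x hx => h hx f rfl) fun h x hx => h hx g rfl

/-- An increasing sequence of irreducible closed sets is eventually constant, because the prime
ideals of these sets have finite height. -/
theorem exists_succ_eq_of_isIrreducible {A : ℕ → Set (GL (Fin n) K)} (hmono : Monotone A)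
    (hcl : ∀ k, IsClosed (A k)) (hirr : ∀ k, IsIrreducible (A k)) : ∃ m, A (m + 1) = A m := by
  by_contra! hne
  have hlt : ∀ k, (idealOf (A (k + 1))).height < (idealOf (A k)).height := by
    intro k
    have := isPrime_idealOf (hirr k)
    have := isPrime_idealOf (hirr (k + 1))
    refine Ideal.height_strict_mono_of_isPrime ?_
    refine lt_of_le_of_ne (fun f hf g hg => hf g (hmono k.le_succ hg)) fun heq => hne k ?_
    rw [← zeroSet_idealOf (hcl k), ← zeroSet_idealOf (hcl (k + 1)), heq]
  exact not_strictAnti_of_wellFoundedLT (fun k => (idealOf (A k)).height)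
    (strictAnti_nat_of_succ_lt hlt)

end ZariskiTopology

end GenAlgGroup

/-! ### Images of polynomial maps -/

/-- On a suitable nonempty relatively open subset of an irreducible set, the membership in a
constructible set is constant. -/
theorem Topology.IsConstructible.exists_isOpen_inter_subset {X : Type*} [TopologicalSpace X]
    {Z s : Set X} (hZ : IsIrreducible Z) (hs : Topology.IsConstructible s) :
    ∃ U, IsOpen U ∧ (Z ∩ U).Nonempty ∧ (Z ∩ U ⊆ s ∨ Z ∩ U ⊆ sᶜ) := by
  induction hs using Topology.IsConstructible.empty_union_induction with
  | open_retrocompact U hU _ =>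
    by_cases h : (Z ∩ U).Nonempty
    · exact ⟨U, hU, h, Or.inl Set.inter_subset_right⟩
    · refine ⟨Set.univ, isOpen_univ, by simpa using hZ.nonempty, Or.inr fun x hx hxU => ?_⟩
      exact h ⟨x, hx.1, hxU⟩
  | union s _ t _ hs ht =>
    obtain ⟨U, hU, hne, hUs⟩ := hs
    obtain ⟨V, hV, hne', hVt⟩ := ht
    rcases hUs with hUs | hUs
    · exact ⟨U, hU, hne, Or.inl (hUs.trans Set.subset_union_left)⟩
    rcases hVt with hVt | hVt
    · exact ⟨V, hV, hne', Or.inl (hVt.trans Set.subset_union_right)⟩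
    refine ⟨U ∩ V, hU.inter hV, hZ.2 U V hU hV hne hne', Or.inr ?_⟩
    rintro x ⟨hxZ, hxU, hxV⟩ (hx | hx)
    · exact hUs ⟨hxZ, hxU⟩ hx
    · exact hVt ⟨hxZ, hxV⟩ hx
  | compl s _ hs =>
    obtain ⟨U, hU, hne, h⟩ := hs
    exact ⟨U, hU, hne, by rw [compl_compl]; exact h.symm⟩

/-- A form of Chevalley's theorem for points over an algebraically closed field: if the closure
`V(I)` of the image of an algebraic set `V(J)` under a polynomial map is irreducible, then the image
contains all points of `V(I)` at which some polynomial `f ∉ I` does not vanish. -/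
theorem MvPolynomial.exists_notMem_comap_forall_exists_aeval {K : Type*} [Field K]
    [IsAlgClosed K] {σ τ : Type*} [Finite σ] [Finite τ]
    (φ : MvPolynomial σ K →ₐ[K] MvPolynomial τ K) (J : Ideal (MvPolynomial τ K))
    (hI : (J.comap φ).IsPrime) :
    ∃ f ∉ J.comap φ, ∀ a ∈ zeroLocus K (J.comap φ), aeval a f ≠ 0 →
      ∃ b ∈ zeroLocus K J, ∀ p, aeval b (φ p) = aeval a p := by
  have hfp : (φ : MvPolynomial σ K →+* MvPolynomial τ K).FinitePresentation := by
    refine RingHom.FinitePresentation.of_finiteType.1 ?_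
    refine RingHom.FiniteType.of_comp_finiteType (f := MvPolynomial.C) ?_
    have : (φ : MvPolynomial σ K →+* MvPolynomial τ K).comp MvPolynomial.C = MvPolynomial.C :=
      φ.comp_algebraMap
    rw [this]
    exact RingHom.finiteType_algebraMap.2 inferInstance
  set C := PrimeSpectrum.comap (φ : MvPolynomial σ K →+* MvPolynomial τ K) ''
    PrimeSpectrum.zeroLocus (J : Set (MvPolynomial τ K))
  have hCcon : Topology.IsConstructible C := by
    refine PrimeSpectrum.isConstructible_comap_image hfp ?_
    refine Topology.isConstructible_compl.1 (IsRetrocompact.isConstructible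
      (PrimeSpectrum.isClosed_zeroLocus _).isOpen_compl
      (PrimeSpectrum.isRetrocompact_zeroLocus_compl_of_fg (IsNoetherian.noetherian J)))
  have hcl : closure C = PrimeSpectrum.zeroLocus (J.comap φ : Set (MvPolynomial σ K)) :=
    PrimeSpectrum.closure_image_comap_zeroLocus _ J
  have hirr : IsIrreducible (PrimeSpectrum.zeroLocus (J.comap φ : Set (MvPolynomial σ K))) := by
    rw [PrimeSpectrum.isIrreducible_zeroLocus_iff, hI.radical]
    exact hI
  obtain ⟨U, hU, ⟨P, hPZ, hPU⟩, hUC⟩ := hCcon.exists_isOpen_inter_subset hirr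
  -- The image `C` is dense in `V(I)`, so it meets every open set that meets `V(I)`.
  replace hUC := hUC.resolve_right fun hUC => by
    obtain ⟨Q, hQU, hQC⟩ := mem_closure_iff.1 (hcl ▸ hPZ) U hU hPU
    exact hUC ⟨hcl ▸ subset_closure hQC, hQU⟩ hQC
  obtain ⟨_, ⟨f, rfl⟩, hPf, hfU⟩ :=
    PrimeSpectrum.isTopologicalBasis_basic_opens.exists_subset_of_mem_open hPU hU
  -- The maximal ideal of `a` is the contraction of a prime `Q ⊇ J`; any zero `b` of `Q` lies over `a`.
  refine ⟨f, fun hf => hPf (hPZ hf), fun a ha hfa => ?_⟩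
  obtain ⟨Q, hQJ, hQ⟩ : (pointToPoint a : PrimeSpectrum (MvPolynomial σ K)) ∈ C :=
    hUC ⟨fun p hp => (mem_vanishingIdeal_singleton_iff a p).2 (ha p hp),
      hfU fun h => hfa ((mem_vanishingIdeal_singleton_iff a f).1 h)⟩
  obtain ⟨b, hb⟩ : (zeroLocus K Q.asIdeal).Nonempty := by
    by_contra hemp
    have h := IsPrime.vanishingIdeal_zeroLocus (K := K) Q.asIdeal
    rw [Set.not_nonempty_iff_eq_empty.1 hemp, vanishingIdeal_empty] at h
    exact Q.isPrime.ne_top h.symm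
  refine ⟨b, fun p hp => hb p (hQJ hp), fun p => ?_⟩
  have hp : p - MvPolynomial.C (aeval a p) ∈
      (pointToPoint a : PrimeSpectrum (MvPolynomial σ K)).asIdeal :=
    (mem_vanishingIdeal_singleton_iff a _).2 (by simp)
  rw [← hQ] at hp
  have := hb _ hp
  simpa [sub_eq_zero] using this

namespace GenAlgGroup

attribute [local instance] zariski

variable {F K : Type*} [Field F] [Field K] [Algebra F K] {n : ℕ}

/-- The comorphism of matrix multiplication, with values in the polynomials in two matrices and one
further indeterminate. -/
noncomputable def mulComorphism (n : ℕ) (F : Type*) [Field F] :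
    MatPoly n F →ₐ[F] MvPolynomial (PairVar n) F :=
  MvPolynomial.aeval fun p => (genX n F * genY n F) p.1 p.2

/-- The point of the affine space with coordinates `PairVar n` given by two matrices and a value
for the further indeterminate. -/
def pairPoint (x y : Matrix (Fin n) (Fin n) K) (t : K) : PairVar n → K
  | none => t
  | some (Sum.inl p) => x p.1 p.2
  | some (Sum.inr p) => y p.1 p.2

theorem aeval_mulComorphism (b : PairVar n → K) (z : Matrix (Fin n) (Fin n) K)
    (hz : ∀ i j, z i j = ∑ k, b (some (Sum.inl (i, k))) * b (some (Sum.inr (k, j))))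
    (f : MatPoly n F) :
    MvPolynomial.aeval b (mulComorphism n F f) = MvPolynomial.aeval (fun p => z p.1 p.2) f := by
  have : (MvPolynomial.aeval b).comp (mulComorphism n F) =
      MvPolynomial.aeval (fun p => z p.1 p.2) := by
    ext p
    simp [mulComorphism, genX, genY, Matrix.mul_apply, hz]
  exact DFunLike.congr_fun this f

theorem aeval_pairPoint_mulComorphism (x y : GL (Fin n) K) (t : K) (f : MatPoly n F) :
    MvPolynomial.aeval (pairPoint x.1 y.1 t) (mulComorphism n F f) = evalGL (x * y) f :=
  aeval_mulComorphism _ (x * y).1 (fun i j => by simp [pairPoint, Matrix.mul_apply]) f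

theorem aeval_pairPoint_rename_inl (x y : GL (Fin n) K) (t : K) (f : MatPoly n F) :
    MvPolynomial.aeval (pairPoint x.1 y.1 t)
      (MvPolynomial.rename (fun p => (some (Sum.inl p) : PairVar n)) f) = evalGL x f := by
  rw [MvPolynomial.aeval_rename]
  rfl

theorem aeval_pairPoint_rename_inr (x y : GL (Fin n) K) (t : K) (f : MatPoly n F) :
    MvPolynomial.aeval (pairPoint x.1 y.1 t)
      (MvPolynomial.rename (fun p => (some (Sum.inr p) : PairVar n)) f) = evalGL y f := by
  rw [MvPolynomial.aeval_rename]
  rfl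

theorem aeval_det_genX (b : PairVar n → K) : MvPolynomial.aeval b (genX n F).det =
    (Matrix.of fun i j => b (some (Sum.inl (i, j)))).det := by
  rw [AlgHom.map_det]
  congr 1
  ext i j
  simp [genX]

theorem aeval_det_genY (b : PairVar n → K) : MvPolynomial.aeval b (genY n F).det =
    (Matrix.of fun i j => b (some (Sum.inr (i, j)))).det := by
  rw [AlgHom.map_det]
  congr 1
  ext i j
  simp [genY]

/-- Coordinates with invertible matrix parts come from a pair of elements of `GL(n, K)`. -/
theorem exists_eq_pairPoint {b : PairVar n → K}
    (hx : MvPolynomial.aeval b (genX n F).det ≠ 0)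
    (hy : MvPolynomial.aeval b (genY n F).det ≠ 0) :
    ∃ x y : GL (Fin n) K, b = pairPoint x.1 y.1 (b none) := by
  rw [aeval_det_genX] at hx
  rw [aeval_det_genY] at hy
  refine ⟨Matrix.GeneralLinearGroup.mkOfDetNeZero _ hx,
    Matrix.GeneralLinearGroup.mkOfDetNeZero _ hy, ?_⟩
  ext (_ | p | p) <;> rfl

/-- If `P` and `B` are irreducible, `B` is closed and `P` has an open core, then `P * B` has an open
core. Chevalley's theorem is applied to the restriction of the multiplication map to the product
of a principal open subset of the closure of `P` with `B`, which is made an algebraic set by means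
of the further indeterminate. -/
theorem hasOpenCore_mul [IsAlgClosed K] {P B : Set (GL (Fin n) K)} (hP : HasOpenCore P)
    (hPirr : IsIrreducible P) (hB : IsClosed B) (hBirr : IsIrreducible B) :
    HasOpenCore (P * B) := by
  obtain ⟨V, hV, ⟨u, huP, huV⟩, hVP⟩ := hP
  obtain ⟨S, hS⟩ := isClosed_iff_exists_zeroSet.1 hV.isClosed_compl
  have hu : u ∉ zeroSet K S := hS ▸ fun h => h huV
  obtain ⟨h, hhS, hhu⟩ : ∃ h ∈ S, evalGL u h ≠ 0 := by simpa [zeroSet] using hu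
  set U : Set (GL (Fin n) K) := closure P ∩ {x | evalGL x h ≠ 0}
  have hopen : IsOpen {x : GL (Fin n) K | evalGL x h ≠ 0} := by
    convert (isClosed_zeroSet (K := K) {h}).isOpen_compl using 1
    ext; simp [zeroSet]
  have hUP : U ⊆ P := by
    rintro x ⟨hxP, hxh⟩
    refine hVP ⟨hxP, by_contra fun hxV => hxh ?_⟩
    have : x ∈ zeroSet K S := hS ▸ hxV
    exact this h hhS
  have hUcl : closure U = closure P :=
    (closure_minimal Set.inter_subset_left isClosed_closure).antisymm
      (closure_minimal (subset_closure.trans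
        (subset_closure_inter_of_isPreirreducible_of_isOpen
          (isIrreducible_iff_closure.2 hPirr).2 hopen ⟨u, huP, hhu⟩)) isClosed_closure)
  have hUirr : IsIrreducible U := by
    rw [← isIrreducible_iff_closure, hUcl, isIrreducible_iff_closure]
    exact hPirr
  have hclosure : closure (U * B) = closure (P * B) := by
    rw [← closure_closure_mul U, hUcl, closure_closure_mul]
  set W : Set (PairVar n → K) := {b | ∃ x ∈ U, ∃ y ∈ B, ∃ t : K,
    t * x.1.det * y.1.det * evalGL x h = 1 ∧ b = pairPoint x.1 y.1 t}
  -- `W` is an algebraic set.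
  have hWcl : ∀ b ∈ MvPolynomial.zeroLocus K (MvPolynomial.vanishingIdeal K W), b ∈ W := by
    intro b hb
    have heq : MvPolynomial.aeval b (MvPolynomial.X none * (genX n K).det * (genY n K).det *
        MvPolynomial.rename (fun p => (some (Sum.inl p) : PairVar n)) h - 1) = 0 := by
      refine hb _ ?_
      rintro _ ⟨x, hx, y, hy, t, ht, rfl⟩
      rw [map_sub, map_mul, map_mul, map_mul, aeval_det_genX, aeval_det_genY,
        aeval_pairPoint_rename_inl, map_one, sub_eq_zero, MvPolynomial.aeval_X]
      exact ht
    rw [map_sub, map_mul, map_mul, map_mul, map_one, sub_eq_zero] at heq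
    have hne := heq ▸ one_ne_zero (α := K)
    simp only [ne_eq, mul_eq_zero, not_or] at hne
    obtain ⟨⟨⟨_, hx⟩, hy⟩, _⟩ := hne
    obtain ⟨x, y, hb'⟩ := exists_eq_pairPoint hx hy
    rw [hb', aeval_det_genX, aeval_det_genY, aeval_pairPoint_rename_inl,
      MvPolynomial.aeval_X] at heq
    refine ⟨x, ⟨mem_closure_iff_forall_evalGL.2 fun f hf => ?_, fun h0 => ?_⟩, y, ?_, b none, heq,
      hb'⟩
    · rw [← aeval_pairPoint_rename_inl x y (b none), ← hb']
      refine hb _ ?_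
      rintro _ ⟨x', hx', y', _, t, _, rfl⟩
      rw [aeval_pairPoint_rename_inl]
      exact mem_closure_iff_forall_evalGL.1 hx'.1 f hf
    · rw [h0, mul_zero] at heq
      exact zero_ne_one heq
    · rw [← hB.closure_eq]
      refine mem_closure_iff_forall_evalGL.2 fun f hf => ?_
      rw [← aeval_pairPoint_rename_inr x y (b none), ← hb']
      refine hb _ ?_
      rintro _ ⟨x', _, y', hy', t, _, rfl⟩
      rw [aeval_pairPoint_rename_inr]
      exact hf y' hy'
  -- Full vanishing ideals are used on both sides, so the contraction is prime without radicals.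
  have hcomap : (MvPolynomial.vanishingIdeal K W).comap (mulComorphism n K) =
      idealOf (U * B) := by
    ext f
    constructor
    · rintro hf _ ⟨x, hx, y, hy, rfl⟩
      rw [← aeval_pairPoint_mulComorphism x y (x.1.det * y.1.det * evalGL x h)⁻¹]
      refine hf _ ⟨x, hx, y, hy, _, ?_, rfl⟩
      rw [mul_assoc, mul_assoc, ← mul_assoc x.1.det]
      exact inv_mul_cancel₀ (mul_ne_zero (mul_ne_zero (det_ne_zero x) (det_ne_zero y)) hx.2)
    · rintro hf _ ⟨x, hx, y, hy, t, _, rfl⟩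
      rw [aeval_pairPoint_mulComorphism]
      exact hf _ (Set.mul_mem_mul hx hy)
  obtain ⟨f, hf, hlift⟩ := MvPolynomial.exists_notMem_comap_forall_exists_aeval
    (mulComorphism n K) (MvPolynomial.vanishingIdeal K W)
    (hcomap ▸ isPrime_idealOf (hUirr.mul_of_separatelyContinuous hBirr))
  rw [hcomap] at hf hlift
  refine ⟨(zeroSet K {f})ᶜ, (isClosed_zeroSet _).isOpen_compl, ?_, ?_⟩
  · by_contra hemp
    refine hf fun z hz => by_contra fun hfz => hemp ⟨z, hclosure ▸ subset_closure hz, ?_⟩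
    simpa [zeroSet] using hfz
  · rintro z ⟨hz, hzf⟩
    rw [← hclosure, mem_closure_iff_forall_evalGL] at hz
    obtain ⟨b, hb, hbz⟩ := hlift (fun p => z.1 p.1 p.2) hz
      fun h0 => hzf fun f' hf' => by rw [hf']; exact h0
    obtain ⟨x, hx, y, hy, t, _, rfl⟩ := hWcl b hb
    refine ⟨x, hUP hx, y, hy, Units.ext (Matrix.ext fun i j => ?_)⟩
    have := hbz (MvPolynomial.X (i, j))
    rwa [aeval_pairPoint_mulComorphism, evalGL_X, MvPolynomial.aeval_X] at this

end GenAlgGroup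

/-! ### The subgroup generated by two irreducible closed subgroups -/

namespace GenAlgGroup

attribute [local instance] zariski

variable {K : Type*} [Field K] {n : ℕ} (G₁ G₂ : Subgroup (GL (Fin n) K))

/-- The set `G₁ G₂ G₁ G₂ ⋯ G₁ G₂` with `k` factors `G₁ G₂`. -/
def alternatingProduct : ℕ → Set (GL (Fin n) K)
  | 0 => {1}
  | k + 1 => alternatingProduct k * (G₁ : Set (GL (Fin n) K)) * (G₂ : Set (GL (Fin n) K))

theorem afterRounds_succ (k : ℕ) :
    afterRounds G₁ G₂ (k + 1) = round G₁ G₂ (afterRounds G₁ G₂ k) :=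
  Function.iterate_succ_apply' ..

theorem round_eq_closure (A : Set (GL (Fin n) K)) :
    round G₁ G₂ A = closure (A * (G₁ : Set (GL (Fin n) K)) * (G₂ : Set (GL (Fin n) K))) :=
  closure_closure_mul _ _

theorem afterRounds_eq_closure (k : ℕ) :
    afterRounds G₁ G₂ k = closure (alternatingProduct G₁ G₂ k) := by
  induction k with
  | zero => exact isClosed_singleton_one.closure_eq.symm
  | succ k ih =>
    rw [afterRounds_succ, ih, round_eq_closure, alternatingProduct, mul_assoc,
      closure_closure_mul, ← mul_assoc]

theorem alternatingProduct_subset_sup (k : ℕ) :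
    alternatingProduct G₁ G₂ k ⊆ ((G₁ ⊔ G₂ : Subgroup (GL (Fin n) K)) : Set _) := by
  induction k with
  | zero => exact Set.singleton_subset_iff.2 (one_mem _)
  | succ k ih =>
    rintro _ ⟨_, ⟨x, hx, y, hy, rfl⟩, z, hz, rfl⟩
    exact mul_mem (mul_mem (ih hx) (Subgroup.mem_sup_left hy)) (Subgroup.mem_sup_right hz)

theorem alternatingProduct_mono : Monotone (alternatingProduct G₁ G₂) := by
  refine monotone_nat_of_le_succ fun k x hx => ?_
  have := Set.mul_mem_mul (Set.mul_mem_mul hx G₁.one_mem) G₂.one_mem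
  rwa [mul_one, mul_one] at this

/-- A stable set of the iteration is closed under right multiplication by `G₁` and by `G₂` and
contains `1`, hence contains the closure of the generated subgroup. -/
theorem StopsAt.afterRounds_eq_closure_sup {m : ℕ} (hm : StopsAt G₁ G₂ m) :
    afterRounds G₁ G₂ m =
      closure ((G₁ ⊔ G₂ : Subgroup (GL (Fin n) K)) : Set (GL (Fin n) K)) := by
  refine Set.Subset.antisymm ?_ ?_
  · rw [afterRounds_eq_closure]
    exact closure_mono (alternatingProduct_subset_sup G₁ G₂ m)
  rw [StopsAt, round_eq_closure] at hm
  have hmem : ∀ a ∈ afterRounds G₁ G₂ m, ∀ x ∈ G₁, ∀ y ∈ G₂,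
      a * x * y ∈ afterRounds G₁ G₂ m := fun a ha x hx y hy =>
    hm ▸ subset_closure (Set.mul_mem_mul (Set.mul_mem_mul ha hx) hy)
  have hone : 1 ∈ afterRounds G₁ G₂ m := by
    rw [afterRounds_eq_closure]
    exact subset_closure (alternatingProduct_mono G₁ G₂ m.zero_le rfl)
  have hmul : ∀ x ∈ G₁ ⊔ G₂, ∀ a ∈ afterRounds G₁ G₂ m, a * x ∈ afterRounds G₁ G₂ m := by
    intro x hx
    rw [Subgroup.sup_eq_closure] at hx
    induction hx using Subgroup.closure_induction'' with
    | one => simp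
    | mem x hx =>
      intro a ha
      rcases hx with hx | hx
      · simpa using hmem a ha x hx 1 G₂.one_mem
      · simpa using hmem a ha 1 G₁.one_mem x hx
    | inv_mem x hx =>
      intro a ha
      rcases hx with hx | hx
      · simpa using hmem a ha x⁻¹ (G₁.inv_mem hx) 1 G₂.one_mem
      · simpa using hmem a ha 1 G₁.one_mem x⁻¹ (G₂.inv_mem hx)
    | mul x y _ _ hx hy =>
      intro a ha
      rw [← mul_assoc]
      exact hy _ (hx a ha)
  refine closure_minimal (fun x hx => by simpa using hmul x hx 1 hone) ?_
  rw [afterRounds_eq_closure]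
  exact isClosed_closure

variable {G₁ G₂}

theorem isIrreducible_alternatingProduct (h₁ : IsIrreducible (G₁ : Set (GL (Fin n) K)))
    (h₂ : IsIrreducible (G₂ : Set (GL (Fin n) K))) (k : ℕ) :
    IsIrreducible (alternatingProduct G₁ G₂ k) := by
  induction k with
  | zero => exact isIrreducible_singleton
  | succ k ih =>
    exact (ih.mul_of_separatelyContinuous h₁).mul_of_separatelyContinuous h₂

theorem hasOpenCore_alternatingProduct [IsAlgClosed K]
    (hG₁ : IsClosed (G₁ : Set (GL (Fin n) K))) (hG₂ : IsClosed (G₂ : Set (GL (Fin n) K)))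
    (h₁ : IsIrreducible (G₁ : Set (GL (Fin n) K)))
    (h₂ : IsIrreducible (G₂ : Set (GL (Fin n) K))) (k : ℕ) :
    HasOpenCore (alternatingProduct G₁ G₂ k) := by
  induction k with
  | zero =>
    refine ⟨Set.univ, isOpen_univ, ⟨1, subset_closure rfl, trivial⟩, ?_⟩
    rw [alternatingProduct, isClosed_singleton_one.closure_eq]
    exact Set.inter_subset_left
  | succ k ih =>
    have hirr := isIrreducible_alternatingProduct h₁ h₂ k
    exact hasOpenCore_mul (hasOpenCore_mul ih hirr hG₁ h₁)
      (hirr.mul_of_separatelyContinuous h₁) hG₂ h₂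

theorem exists_stopsAt (h₁ : IsIrreducible (G₁ : Set (GL (Fin n) K)))
    (h₂ : IsIrreducible (G₂ : Set (GL (Fin n) K))) : ∃ m, StopsAt G₁ G₂ m := by
  obtain ⟨m, hm⟩ := exists_succ_eq_of_isIrreducible (A := afterRounds G₁ G₂)
    (fun i j hij => by
      rw [afterRounds_eq_closure, afterRounds_eq_closure]
      exact closure_mono (alternatingProduct_mono G₁ G₂ hij))
    (fun k => by rw [afterRounds_eq_closure]; exact isClosed_closure)
    (fun k => by
      rw [afterRounds_eq_closure]
      exact isIrreducible_iff_closure.2 (isIrreducible_alternatingProduct h₁ h₂ k))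
  exact ⟨m, by rw [StopsAt, ← afterRounds_succ, hm]⟩

/-- The generated subgroup is closed: it has the open core of the alternating product whose closure
is its own closure. -/
theorem isClosed_sup [IsAlgClosed K]
    (hG₁ : IsClosed (G₁ : Set (GL (Fin n) K))) (hG₂ : IsClosed (G₂ : Set (GL (Fin n) K)))
    (h₁ : IsIrreducible (G₁ : Set (GL (Fin n) K)))
    (h₂ : IsIrreducible (G₂ : Set (GL (Fin n) K))) :
    IsClosed ((G₁ ⊔ G₂ : Subgroup (GL (Fin n) K)) : Set (GL (Fin n) K)) := by
  obtain ⟨m, hm⟩ := exists_stopsAt h₁ h₂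
  have heq := hm.afterRounds_eq_closure_sup
  rw [afterRounds_eq_closure] at heq
  refine Subgroup.isClosed_of_hasOpenCore continuous_inv_zariski _ ?_ ?_
  · rw [← isIrreducible_iff_closure, ← heq, isIrreducible_iff_closure]
    exact isIrreducible_alternatingProduct h₁ h₂ m
  · obtain ⟨V, hV, hne, hsub⟩ := hasOpenCore_alternatingProduct hG₁ hG₂ h₁ h₂ m
    exact ⟨V, hV, heq ▸ hne, heq ▸ hsub.trans (alternatingProduct_subset_sup G₁ G₂ m)⟩

end GenAlgGroup

/-! ### Linear functionals on coefficients -/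

namespace MvPolynomial

section MapCoeff

variable {R A : Type*} [CommRing R] [CommRing A] [Algebra R A] {σ τ : Type*}

/-- The polynomial over `R` obtained from a polynomial over `A` by applying an `R`-linear functional
`l : A → R` to all coefficients. -/
noncomputable def mapCoeff (l : A →ₗ[R] R) : MvPolynomial σ A →ₗ[R] MvPolynomial σ R :=
  (AddMonoidAlgebra.coeffLinearEquiv R).symm.toLinearMap ∘ₗ Finsupp.mapRange.linearMap l ∘ₗ
    (AddMonoidAlgebra.coeffLinearEquiv R).toLinearMap

theorem coeff_mapCoeff (l : A →ₗ[R] R) (f : MvPolynomial σ A) (m : σ →₀ ℕ) :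
    coeff m (mapCoeff l f) = l (coeff m f) := rfl

theorem mapCoeff_C_mul_map (l : A →ₗ[R] R) (c : A) (g : MvPolynomial σ R) :
    mapCoeff l (C c * map (algebraMap R A) g) = C (l c) * g := by
  ext m
  rw [coeff_mapCoeff, coeff_C_mul, coeff_C_mul, coeff_map, mul_comm, ← Algebra.smul_def, map_smul,
    smul_eq_mul, mul_comm]

/-- Polynomials over `A` are sums of multiples `c g` with `c ∈ A` and `g` with coefficients
in `R`. -/
@[elab_as_elim]
theorem induction_on_C_mul_map {p : MvPolynomial σ A → Prop} (f : MvPolynomial σ A)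
    (C_mul_map : ∀ c g, p (C c * map (algebraMap R A) g))
    (add : ∀ f g, p f → p g → p (f + g)) : p f := by
  induction f using MvPolynomial.induction_on' with
  | monomial m c =>
    have := C_mul_map c (monomial m 1)
    rwa [map_monomial, map_one, C_mul_monomial, mul_one] at this
  | add f g hf hg => exact add f g hf hg

theorem mapCoeff_mul_map (l : A →ₗ[R] R) (f : MvPolynomial σ A) (g : MvPolynomial σ R) :
    mapCoeff l (f * map (algebraMap R A) g) = mapCoeff l f * g := by
  refine induction_on_C_mul_map (R := R) f (fun c h => ?_) fun f h hf hh => ?_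
  · rw [mul_assoc, ← map_mul, mapCoeff_C_mul_map, mapCoeff_C_mul_map, mul_assoc]
  · rw [add_mul, map_add, hf, hh, map_add, add_mul]

/-- Functionals on coefficients map the extension of an ideal to `A` back into the ideal. -/
theorem mapCoeff_mem_of_mem_map (l : A →ₗ[R] R) {J : Ideal (MvPolynomial σ R)}
    {f : MvPolynomial σ A} (hf : f ∈ J.map (map (algebraMap R A))) : mapCoeff l f ∈ J := by
  induction hf using Submodule.span_induction generalizing l with
  | mem f hf =>
    obtain ⟨g, hg, rfl⟩ := hf
    have := mapCoeff_mul_map l 1 g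
    rw [one_mul] at this
    exact this ▸ J.mul_mem_left _ hg
  | zero => simp
  | add f g _ _ hf hg => rw [map_add]; exact J.add_mem (hf l) (hg l)
  | smul q f _ hf =>
    rw [smul_eq_mul]
    induction q using MvPolynomial.induction_on generalizing l with
    | C c =>
      have : mapCoeff l (C c * f) = mapCoeff (l ∘ₗ LinearMap.mulLeft R c) f := by
        ext m
        simp [coeff_mapCoeff, coeff_C_mul]
      exact this ▸ hf _
    | add p q hp hq => rw [add_mul, map_add]; exact J.add_mem (hp l) (hq l)
    | mul_X p i hp =>
      have := mapCoeff_mul_map l (p * f) (X i)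
      rw [map_X, mul_right_comm] at this
      rw [this]
      exact J.mul_mem_right _ (hp l)

/-- Substitution of polynomials over `R` commutes with functionals on coefficients. -/
theorem mapCoeff_aeval_map (l : A →ₗ[R] R) (q : σ → MvPolynomial τ R) (f : MvPolynomial σ A) :
    mapCoeff l (aeval (fun i => map (algebraMap R A) (q i)) f) = aeval q (mapCoeff l f) := by
  refine induction_on_C_mul_map (R := R) f (fun c g => ?_) fun f g hf hg => ?_
  · have h : aeval (fun i => map (algebraMap R A) (q i)) (map (algebraMap R A) g) =
        map (algebraMap R A) (aeval q g) := by
      rw [aeval_map_algebraMap]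
      have : (aeval fun i => map (algebraMap R A) (q i)) =
          (mapAlgHom (Algebra.ofId R A)).comp (aeval q) := by
        ext i
        simp [mapAlgHom]
        rfl
      rw [this]
      rfl
    rw [map_mul, aeval_C, h, algebraMap_eq, mapCoeff_C_mul_map, mapCoeff_C_mul_map, map_mul,
      aeval_C, algebraMap_eq]
  · rw [map_add, map_add, hf, hg, map_add, map_add]

end MapCoeff

/-- Over a field, a polynomial over `A` is a combination, with coefficients in `A`, of the
polynomials obtained from it by functionals on coefficients. -/
theorem mem_span_range_map_mapCoeff {k A : Type*} [Field k] [CommRing A] [Algebra k A] {σ : Type*}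
    (f : MvPolynomial σ A) :
    f ∈ Ideal.span (Set.range fun l : A →ₗ[k] k => map (algebraMap k A) (mapCoeff l f)) := by
  classical
  let b := Module.Free.chooseBasis k A
  let s := f.support.biUnion fun m => (b.repr (coeff m f)).support
  have hf : f = ∑ i ∈ s, C (b i) * map (algebraMap k A) (mapCoeff (b.coord i) f) := by
    ext m
    simp only [coeff_sum, coeff_C_mul, coeff_map, coeff_mapCoeff, Module.Basis.coord_apply]
    conv_lhs => rw [← b.linearCombination_repr (coeff m f), Finsupp.linearCombination_apply]
    rw [Finsupp.sum_of_support_subset _ _ _ fun i _ => zero_smul k (b i)]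
    · exact Finset.sum_congr rfl fun i _ => by rw [Algebra.smul_def, mul_comm]
    · intro i hi
      refine Finset.mem_biUnion.2 ⟨m, ?_, hi⟩
      rw [mem_support_iff]
      intro h0
      simp [h0] at hi
  have hmem : ∑ i ∈ s, C (b i) * map (algebraMap k A) (mapCoeff (b.coord i) f) ∈
      Ideal.span (Set.range fun l : A →ₗ[k] k => map (algebraMap k A) (mapCoeff l f)) :=
    sum_mem fun i _ => Ideal.mul_mem_left _ _ (Ideal.subset_span ⟨b.coord i, rfl⟩)
  rwa [← hf] at hmem

end MvPolynomial

/-! ### Products of closed sets by elimination -/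

namespace GenAlgGroup

attribute [local instance] zariski

variable {F K : Type*} [Field F] [Field K] [Algebra F K] {n : ℕ}

theorem aeval_pairPoint_eq_zero_of_mem_pairIdeal {I J : Ideal (MatPoly n F)}
    {x y : GL (Fin n) K} (hx : x ∈ zeroSet K (I : Set (MatPoly n F)))
    (hy : y ∈ zeroSet K (J : Set (MatPoly n F))) {p : MvPolynomial (PairVar n) F}
    (hp : p ∈ pairIdeal I J) :
    MvPolynomial.aeval (pairPoint x.1 y.1 (x.1.det * y.1.det)⁻¹) p = 0 := by
  suffices pairIdeal I J ≤ RingHom.ker (MvPolynomial.aeval (R := F)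
    (pairPoint x.1 y.1 (x.1.det * y.1.det)⁻¹)) from this hp
  refine sup_le (sup_le (Ideal.map_le_iff_le_comap.2 fun f hf => ?_)
    (Ideal.map_le_iff_le_comap.2 fun f hf => ?_)) (Ideal.span_le.2 ?_)
  · exact (aeval_pairPoint_rename_inl x y _ f).trans (hx f hf)
  · exact (aeval_pairPoint_rename_inr x y _ f).trans (hy f hf)
  · rintro _ rfl
    change MvPolynomial.aeval _ _ = 0
    rw [map_sub, map_mul, map_mul, aeval_det_genX, aeval_det_genY, MvPolynomial.aeval_X, map_one,
      sub_eq_zero, mul_assoc]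
    exact inv_mul_cancel₀ (mul_ne_zero (det_ne_zero x) (det_ne_zero y))

theorem exists_eq_pairPoint_of_mem_zeroLocus_pairIdeal {I J : Ideal (MatPoly n F)}
    {b : PairVar n → K} (hb : b ∈ MvPolynomial.zeroLocus K (pairIdeal I J)) :
    ∃ x ∈ zeroSet K (I : Set (MatPoly n F)), ∃ y ∈ zeroSet K (J : Set (MatPoly n F)),
      b = pairPoint x.1 y.1 (b none) := by
  have heq := hb _ (Ideal.mem_sup_right (Ideal.mem_span_singleton_self _))
  rw [map_sub, map_mul, map_mul, map_one, sub_eq_zero] at heq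
  have hne := heq ▸ one_ne_zero (α := K)
  simp only [ne_eq, mul_eq_zero, not_or] at hne
  obtain ⟨x, y, hxy⟩ := exists_eq_pairPoint hne.1.2 hne.2
  refine ⟨x, fun f hf => ?_, y, fun f hf => ?_, hxy⟩
  · rw [← aeval_pairPoint_rename_inl x y (b none), ← hxy]
    exact hb _ (Ideal.mem_sup_left (Ideal.mem_sup_left (Ideal.mem_map_of_mem _ hf)))
  · rw [← aeval_pairPoint_rename_inr x y (b none), ← hxy]
    exact hb _ (Ideal.mem_sup_left (Ideal.mem_sup_right (Ideal.mem_map_of_mem _ hf)))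

theorem mapCoeff_mulComorphism (l : K →ₗ[F] F) (f : MatPoly n K) :
    MvPolynomial.mapCoeff l (mulComorphism n K f) =
      mulComorphism n F (MvPolynomial.mapCoeff l f) := by
  have h : (fun p : Fin n × Fin n => (genX n K * genY n K) p.1 p.2) =
      fun p => MvPolynomial.map (algebraMap F K) ((genX n F * genY n F) p.1 p.2) := by
    ext1 p
    simp [genX, genY, Matrix.mul_apply]
  rw [mulComorphism, mulComorphism, h, MvPolynomial.mapCoeff_aeval_map]

/-- Elimination computes the closure of a product of zero sets. A polynomial `f` over `K` that
vanishes on the product has, by the Nullstellensatz, a power whose image under the comorphism lies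
in the extension of `pairIdeal I J` to `K`; applying functionals `K → F` to the coefficients of this
power gives elements of `productElim I J`, of which the power is a combination. -/
theorem zeroSet_productElim [IsAlgClosed K] (I J : Ideal (MatPoly n F)) :
    zeroSet K (productElim I J : Set (MatPoly n F)) =
      closure (zeroSet K (I : Set (MatPoly n F)) * zeroSet K (J : Set (MatPoly n F))) := by
  refine Set.Subset.antisymm (fun g hg => ?_) (closure_minimal ?_ (isClosed_zeroSet _))
  · refine mem_closure_iff_forall_evalGL.2 fun f hf => ?_
    have hrad : mulComorphism n K f ∈
        ((pairIdeal I J).map (MvPolynomial.map (algebraMap F K))).radical := by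
      rw [← MvPolynomial.vanishingIdeal_zeroLocus_eq_radical (K := K)]
      intro b hb
      obtain ⟨x, hx, y, hy, hxy⟩ := exists_eq_pairPoint_of_mem_zeroLocus_pairIdeal
        (I := I) (J := J) (b := b) fun p hp => by
          rw [← MvPolynomial.aeval_map_algebraMap K]
          exact hb _ (Ideal.mem_map_of_mem _ hp)
      rw [hxy, aeval_pairPoint_mulComorphism]
      exact hf _ (Set.mul_mem_mul hx hy)
    obtain ⟨N, hN⟩ := hrad
    rw [← map_pow] at hN
    have hmem : ∀ l : K →ₗ[F] F, MvPolynomial.mapCoeff l (f ^ N) ∈ productElim I J := by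
      intro l
      change mulComorphism n F _ ∈ pairIdeal I J
      rw [← mapCoeff_mulComorphism]
      exact MvPolynomial.mapCoeff_mem_of_mem_map l hN
    have hker : Ideal.span (Set.range fun l : K →ₗ[F] F =>
        MvPolynomial.map (algebraMap F K) (MvPolynomial.mapCoeff l (f ^ N))) ≤
          RingHom.ker (evalGL (F := K) g) := by
      refine Ideal.span_le.2 ?_
      rintro _ ⟨l, rfl⟩
      exact (evalGL_map g _).trans (hg _ (hmem l))
    have h0 : evalGL g (f ^ N) = 0 := hker (MvPolynomial.mem_span_range_map_mapCoeff (f ^ N))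
    rw [map_pow] at h0
    exact eq_zero_of_pow_eq_zero h0
  · rintro _ ⟨x, hx, y, hy, rfl⟩ f hf
    change evalGL (x * y) f = 0
    rw [← aeval_pairPoint_mulComorphism]
    exact aeval_pairPoint_eq_zero_of_mem_pairIdeal hx hy hf

theorem zeroSet_idealAfterRounds [IsAlgClosed K] {G₁ G₂ : Subgroup (GL (Fin n) K)}
    {S₁ S₂ : Finset (MatPoly n F)}
    (h₁ : zeroSet K (S₁ : Set (MatPoly n F)) = (G₁ : Set (GL (Fin n) K)))
    (h₂ : zeroSet K (S₂ : Set (MatPoly n F)) = (G₂ : Set (GL (Fin n) K))) (k : ℕ) :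
    zeroSet K (idealAfterRounds S₁ S₂ k : Set (MatPoly n F)) = afterRounds G₁ G₂ k := by
  induction k with
  | zero => exact zeroSet_trivialIdeal
  | succ k ih =>
    rw [idealAfterRounds, Function.iterate_succ_apply', ← idealAfterRounds, zeroSet_productElim,
      zeroSet_productElim, zeroSet_span, zeroSet_span, h₁, h₂, ih, afterRounds_succ]
    rfl

end GenAlgGroup

/-! ### Descent of vanishing ideals to the base field -/

theorem Algebra.exists_forall_eq_trace_mul {F L : Type*} [Field F] [Field L] [Algebra F L]
    [FiniteDimensional F L] [Algebra.IsSeparable F L] (l : L →ₗ[F] F) :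
    ∃ c, ∀ x, l x = Algebra.trace F L (c * x) := by
  refine ⟨(LinearMap.BilinForm.toDual _ (traceForm_nondegenerate F L)).symm l, fun x => ?_⟩
  rw [← Algebra.traceForm_apply, LinearMap.BilinForm.apply_toDual_symm_apply]

namespace GenAlgGroup

attribute [local instance] zariski

variable {F K : Type*} [Field F] [Field K] [Algebra F K] {n : ℕ}

theorem evalGL_map_algEquiv (τ : K ≃ₐ[F] K) (g : GL (Fin n) K) (f : MatPoly n K) :
    evalGL (Matrix.GeneralLinearGroup.map (τ : K →+* K) g)
      (MvPolynomial.map (τ : K →+* K) f) = τ (evalGL g f) := by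
  simp only [evalGL, MvPolynomial.aeval_eq_eval]
  induction f using MvPolynomial.induction_on with
  | C c => simp
  | add p q hp hq => simp_all
  | mul_X p i hp => simp_all

/-- The zero set of polynomials over `F` is stable under the automorphisms of `K` over `F`. -/
theorem map_mem_zeroSet (τ : K ≃ₐ[F] K) {S : Set (MatPoly n F)} {g : GL (Fin n) K}
    (hg : g ∈ zeroSet K S) :
    Matrix.GeneralLinearGroup.map (τ : K →+* K) g ∈ zeroSet K S := by
  intro f hf
  have h := evalGL_map_algEquiv τ g (MvPolynomial.map (algebraMap F K) f)
  have hcomp : (τ : K →+* K).comp (algebraMap F K) = algebraMap F K := by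
    ext; simp
  rwa [MvPolynomial.map_map, hcomp, evalGL_map, evalGL_map, hg f hf, map_zero] at h

/-- The vanishing ideal of the zero set of polynomials over `F` is stable under the automorphisms
of `K` over `F`. -/
theorem map_mem_idealOf_zeroSet (τ : K ≃ₐ[F] K) {S : Set (MatPoly n F)} {f : MatPoly n K}
    (hf : f ∈ idealOf (zeroSet K S)) :
    MvPolynomial.map (τ : K →+* K) f ∈ idealOf (zeroSet K S) := by
  intro g hg
  have h := evalGL_map_algEquiv τ
    (Matrix.GeneralLinearGroup.map (τ.symm : K →+* K) g) f
  have hg' : Matrix.GeneralLinearGroup.map (τ : K →+* K)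
      (Matrix.GeneralLinearGroup.map (τ.symm : K →+* K) g) = g := by
    ext i j; simp
  rwa [hg', hf _ (map_mem_zeroSet τ.symm hg), map_zero] at h

/-- A functional `l : K → F` agrees, on the finite extension of `F` generated by the coefficients of
`f`, with `x ↦ tr (c x)` for some `c`. Hence `mapCoeff l f` is a combination of conjugates
of `f`. -/
theorem map_mapCoeff_mem_idealOf_zeroSet [CharZero F] [IsAlgClosed K] [Algebra.IsAlgebraic F K]
    {S : Set (MatPoly n F)} {f : MatPoly n K} (hf : f ∈ idealOf (zeroSet K S)) (l : K →ₗ[F] F) :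
    MvPolynomial.map (algebraMap F K) (MvPolynomial.mapCoeff l f) ∈ idealOf (zeroSet K S) := by
  let L := IntermediateField.adjoin F (f.coeffs : Set K)
  have : FiniteDimensional F L := IntermediateField.finiteDimensional_adjoin
    fun x _ => Algebra.IsIntegral.isIntegral x
  obtain ⟨c, hc⟩ := Algebra.exists_forall_eq_trace_mul (l ∘ₗ L.val.toLinearMap)
  have hext : ∀ σ : L →ₐ[F] K, ∃ τ : K ≃ₐ[F] K, ∀ x : L, τ x = σ x := by
    intro σ
    obtain ⟨τ, hτ⟩ := IsAlgClosed.surjective_domRestrict_of_isAlgebraic (E := K) σ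
    refine ⟨AlgEquiv.ofBijective τ (Algebra.IsAlgebraic.algHom_bijective τ), fun x => ?_⟩
    exact DFunLike.congr_fun hτ x
  choose τ hτ using hext
  have hcoeff : ∀ m, f.coeff m ∈ L := by
    intro m
    by_cases h0 : f.coeff m = 0
    · rw [h0]; exact zero_mem _
    · exact IntermediateField.subset_adjoin _ _ (MvPolynomial.coeff_mem_coeffs m h0)
  have hsum : MvPolynomial.map (algebraMap F K) (MvPolynomial.mapCoeff l f) =
      ∑ σ : L →ₐ[F] K, MvPolynomial.C (σ c) * MvPolynomial.map (τ σ : K →+* K) f := by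
    ext m
    have h := hc ⟨f.coeff m, hcoeff m⟩
    rw [MvPolynomial.coeff_map, MvPolynomial.coeff_mapCoeff, MvPolynomial.coeff_sum]
    change algebraMap F K ((l ∘ₗ L.val.toLinearMap) ⟨f.coeff m, hcoeff m⟩) = _
    rw [h, trace_eq_sum_embeddings K]
    refine Finset.sum_congr rfl fun σ _ => ?_
    rw [map_mul, MvPolynomial.coeff_C_mul, MvPolynomial.coeff_map]
    congr 1
    exact (hτ σ _).symm
  rw [hsum]
  exact Ideal.sum_mem _ fun σ _ => Ideal.mul_mem_left _ _ (map_mem_idealOf_zeroSet (τ σ) hf)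

/-- In characteristic `0`, the zero set of polynomials over `F` is defined over `F`. -/
theorem isDefinedOver_zeroSet [CharZero F] [IsAlgClosed K] [Algebra.IsAlgebraic F K]
    (S : Set (MatPoly n F)) : IsDefinedOver F (zeroSet K S) := by
  refine ⟨{f | MvPolynomial.map (algebraMap F K) f ∈ idealOf (zeroSet K S)},
    le_antisymm (fun f hf => ?_) (Ideal.span_le.2 ?_)⟩
  · refine Ideal.span_mono ?_ (MvPolynomial.mem_span_range_map_mapCoeff (k := F) f)
    rintro _ ⟨l, rfl⟩
    exact ⟨_, map_mapCoeff_mem_idealOf_zeroSet hf l, rfl⟩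
  · rintro _ ⟨f, hf, rfl⟩
    exact hf

theorem exists_finset_span_eq (I : Ideal (MatPoly n F)) :
    ∃ T : Finset (MatPoly n F), Ideal.span (T : Set (MatPoly n F)) = I :=
  IsNoetherian.noetherian I

theorem IsDefinedOver.exists_finset_zeroSet_eq {X : Set (GL (Fin n) K)} (hX : IsDefinedOver F X)
    (hcl : IsClosed X) :
    ∃ T : Finset (MatPoly n F), zeroSet K (T : Set (MatPoly n F)) = X := by
  obtain ⟨S, hS⟩ := hX
  obtain ⟨T, hT⟩ := exists_finset_span_eq (Ideal.span S)
  refine ⟨T, ?_⟩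
  rw [← zeroSet_span, hT, zeroSet_span, ← zeroSet_idealOf hcl, hS, zeroSet_span]
  ext g
  simp [zeroSet, evalGL_map]

end GenAlgGroup

theorem mainTheorem1 {F K : Type*} [Field F] [CharZero F] [Field K] [Algebra F K]
    [IsAlgClosure F K] (n : ℕ) (G₁ G₂ : Subgroup (GL (Fin n) K))
    (hG₁ : GenAlgGroup.IsAlgebraicSubgroup G₁) (hG₂ : GenAlgGroup.IsAlgebraicSubgroup G₂)
    (hc₁ : GenAlgGroup.IsZariskiConnected G₁) (hc₂ : GenAlgGroup.IsZariskiConnected G₂) :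
    -- termination
    (∃ m : ℕ, GenAlgGroup.StopsAt G₁ G₂ m) ∧
    -- the stable set is the group generated by `G₁` and `G₂`
    (∀ m : ℕ, GenAlgGroup.StopsAt G₁ G₂ m →
      GenAlgGroup.afterRounds G₁ G₂ m = ((G₁ ⊔ G₂ : Subgroup (GL (Fin n) K)) : Set _)) ∧
    -- which is the smallest algebraic subgroup containing `G₁` and `G₂`
    IsLeast {H : Subgroup (GL (Fin n) K) |
      GenAlgGroup.IsAlgebraicSubgroup H ∧ G₁ ≤ H ∧ G₂ ≤ H} (G₁ ⊔ G₂) ∧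
    -- and is defined over `F` if `G₁` and `G₂` are
    (GenAlgGroup.IsDefinedOver F (G₁ : Set (GL (Fin n) K)) →
      GenAlgGroup.IsDefinedOver F (G₂ : Set (GL (Fin n) K)) →
      GenAlgGroup.IsDefinedOver F ((G₁ ⊔ G₂ : Subgroup (GL (Fin n) K)) : Set (GL (Fin n) K))) ∧
    -- from defining polynomials over `F` of the input, the iteration, carried out by elimination
    -- over `F`, yields defining polynomials over `F` of every intermediate set and of the output
    (∀ S₁ S₂ : Finset (GenAlgGroup.MatPoly n F),
      GenAlgGroup.zeroSet K (S₁ : Set (GenAlgGroup.MatPoly n F)) = (G₁ : Set (GL (Fin n) K)) →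
      GenAlgGroup.zeroSet K (S₂ : Set (GenAlgGroup.MatPoly n F)) = (G₂ : Set (GL (Fin n) K)) →
      (∀ k : ℕ, GenAlgGroup.zeroSet K
          (GenAlgGroup.idealAfterRounds S₁ S₂ k : Set (GenAlgGroup.MatPoly n F)) =
        GenAlgGroup.afterRounds G₁ G₂ k) ∧
      ∀ m : ℕ, GenAlgGroup.StopsAt G₁ G₂ m →
        ∃ T : Finset (GenAlgGroup.MatPoly n F),
          Ideal.span (T : Set (GenAlgGroup.MatPoly n F)) =
            GenAlgGroup.idealAfterRounds S₁ S₂ m ∧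
          GenAlgGroup.zeroSet K (T : Set (GenAlgGroup.MatPoly n F)) =
            ((G₁ ⊔ G₂ : Subgroup (GL (Fin n) K)) : Set (GL (Fin n) K))) := by
  have : IsAlgClosed K := IsAlgClosure.isAlgClosed F
  let := GenAlgGroup.zariski n K
  have hcl₁ := GenAlgGroup.isClosed_of_isAlgebraicSubgroup hG₁
  have hcl₂ := GenAlgGroup.isClosed_of_isAlgebraicSubgroup hG₂
  have hirr₁ : IsIrreducible (G₁ : Set (GL (Fin n) K)) := G₁.isIrreducible_of_isConnected hc₁
  have hirr₂ : IsIrreducible (G₂ : Set (GL (Fin n) K)) := G₂.isIrreducible_of_isConnected hc₂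
  have hcl := GenAlgGroup.isClosed_sup hcl₁ hcl₂ hirr₁ hirr₂
  have hcorrect : ∀ m : ℕ, GenAlgGroup.StopsAt G₁ G₂ m →
      GenAlgGroup.afterRounds G₁ G₂ m = ((G₁ ⊔ G₂ : Subgroup (GL (Fin n) K)) : Set _) :=
    fun m hm => hm.afterRounds_eq_closure_sup.trans hcl.closure_eq
  obtain ⟨m, hm⟩ := GenAlgGroup.exists_stopsAt hirr₁ hirr₂
  refine ⟨⟨m, hm⟩, hcorrect, ⟨⟨GenAlgGroup.isClosed_iff_exists_zeroSet.1 hcl, le_sup_left,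
    le_sup_right⟩, fun H hH => sup_le hH.2.1 hH.2.2⟩, fun hd₁ hd₂ => ?_,
    fun S₁ S₂ h₁ h₂ => ⟨GenAlgGroup.zeroSet_idealAfterRounds h₁ h₂, fun k hk => ?_⟩⟩
  · obtain ⟨S₁, h₁⟩ := hd₁.exists_finset_zeroSet_eq hcl₁
    obtain ⟨S₂, h₂⟩ := hd₂.exists_finset_zeroSet_eq hcl₂
    rw [← hcorrect m hm, ← GenAlgGroup.zeroSet_idealAfterRounds h₁ h₂]
    exact GenAlgGroup.isDefinedOver_zeroSet _
  · obtain ⟨T, hT⟩ := GenAlgGroup.exists_finset_span_eq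
      (GenAlgGroup.idealAfterRounds S₁ S₂ k)
    refine ⟨T, hT, ?_⟩
    rw [← GenAlgGroup.zeroSet_span, hT, GenAlgGroup.zeroSet_idealAfterRounds h₁ h₂,
      hcorrect k hk]
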